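/- Consider a finite directed network with node set $\mathcal V$ and link set $\mathcal E$, carrying a finite set of commodities $\ell=1,\dots,C$, with per-commodity buffers: node $i$ has a buffer of size $b_i\in[0,\infty]$ and allots to commodity $p$ a portion $b_i^{(p)}\in[0,\infty]$, where $\sum_p b_i^{(p)}\le b_i$. A queue length vector $\mathbf q=(q_i^{(p)})_{i,p}$ of real numbers is feasible if $0\le q_i^{(p)}\le b_i^{(p)}$ for all $i,p$. Write $\mathbf q_i=(q_i^{(p)})_{p}$. Under a local stationary policy, commodity $\ell$ is transmitted over the link $(i,j)\in\mathcal E$ at rate $g_{ij}^{(\ell)}(\mathbf q_i,\mathbf q_j)$ and leaves the network from node $i$ at rate $g_{iT}^{(\ell)}(\mathbf q_i)$; these rates are assumed to be continuous functions of the feasible queue lengths (in particular, they may be differentiable). With constant arrival rates $\lambda_i^{(\ell)}$, the queue dynamics are $\dot q_i^{(\ell)}=f_i^{(\ell)}(\mathbf q)$, where $$f_i^{(\ell)}(\mathbf q)=\lambda_i^{(\ell)}+\sum_{k:(k,i)\in\mathcal E} g_{ki}^{(\ell)}(\mathbf q_k,\mathbf q_i)-\sum_{j:(i,j)\in\mathcal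 E} g_{ij}^{(\ell)}(\mathbf q_i,\mathbf q_j)-g_{iT}^{(\ell)}(\mathbf q_i).$$ An equilibrium point is a vector $\mathbf q$ with $f_i^{(\ell)}(\mathbf q)=0$ for all $i,\ell$. **Lemma.** Let $\underline b_i^{(p)}\le\bar b_i^{(p)}$ be real numbers, for all nodes $i$ and commodities $p$, such that every point of the box $\bar{\mathcal B}=\prod_{i}\prod_{p}[\underline b_i^{(p)},\bar b_i^{(p)}]$ is feasible. Suppose that for every commodity $\ell$, every node $i$ and every $\mathbf q\in\bar{\mathcal B}$: (i) if $q_i^{(\ell)}=\bar b_i^{(\ell)}$, then $f_i^{(\ell)}(\mathbf q)\le 0$; (ii) if $q_i^{(\ell)}=\underline b_i^{(\ell)}$, then $f_i^{(\ell)}(\mathbf q)\ge 0$. Then there exists a feasible equilibrium point $\mathbf q\in\bar{\mathcal B}$. -/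

import Mathlib

open scoped ENNReal

/-- A finite directed communication network on the node set `V`, carrying the commodities `K`,
with per-commodity buffers: node `i` has a buffer of size `buffer i` (possibly infinite), of which
it allots the portion `alloc i p` to commodity `p`. `arrival i p` is the rate at which packets of
commodity `p` are injected at node `i`. -/
structure BufferedNetwork (V K : Type*) [Fintype K] where
  graph : Digraph V
  buffer : V → ℝ≥0∞
  alloc : V → K → ℝ≥0∞
  sum_alloc_le : ∀ i, ∑ p, alloc i p ≤ buffer i
  arrival : V → K → ℝ

/-- A local stationary policy: `rate ℓ i j x y` is the transmission rate of commodity `ℓ` on the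
link `(i, j)` when the queue lengths (of all commodities) are `x` at node `i` and `y` at node `j`;
`depart ℓ i x` is the rate at which commodity `ℓ` leaves the network from node `i` when the queue
lengths at node `i` are `x`. -/
structure LocalPolicy (V K : Type*) where
  rate : K → V → V → (K → ℝ) → (K → ℝ) → ℝ
  depart : K → V → (K → ℝ) → ℝ

namespace BufferedNetwork

variable {V K : Type*} [Fintype K]

/-- The feasible queue lengths at node `i`: between zero and the allotted buffer size, for each
commodity. -/
def feasibleAt (S : BufferedNetwork V K) (i : V) : Set (K → ℝ) :=
  {x | ∀ p, 0 ≤ x p ∧ ENNReal.ofReal (x p) ≤ S.alloc i p}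

/-- The feasible queue length vectors; `q i p` is the queue length of commodity `p` at node `i`. -/
def feasible (S : BufferedNetwork V K) : Set (V → K → ℝ) :=
  {q | ∀ i, q i ∈ S.feasibleAt i}

/-- The rates of the policy `g` are continuous functions of the feasible queue lengths on which
they depend. -/
structure ContinuousPolicy (S : BufferedNetwork V K) (g : LocalPolicy V K) : Prop where
  rate : ∀ ℓ i j, S.graph.Adj i j →
    ContinuousOn (fun z : (K → ℝ) × (K → ℝ) => g.rate ℓ i j z.1 z.2)
      (S.feasibleAt i ×ˢ S.feasibleAt j)
  depart : ∀ ℓ i, ContinuousOn (g.depart ℓ i) (S.feasibleAt i)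

open Classical in
/-- The right-hand side `f_i^(ℓ)(q)` of the queueing dynamics: arrivals, plus inflow over the
incoming links, minus outflow over the outgoing links, minus departures. -/
noncomputable def dynamics [Fintype V] (S : BufferedNetwork V K) (g : LocalPolicy V K)
    (q : V → K → ℝ) (i : V) (ℓ : K) : ℝ :=
  S.arrival i ℓ + ∑ k with S.graph.Adj k i, g.rate ℓ k i (q k) (q i)
    - ∑ j with S.graph.Adj i j, g.rate ℓ i j (q i) (q j) - g.depart ℓ i (q i)

/-- `q` is an equilibrium point of the dynamics `dq/dt = f(q)`. -/
def IsEquilibrium [Fintype V] (S : BufferedNetwork V K) (g : LocalPolicy V K)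
    (q : V → K → ℝ) : Prop :=
  ∀ i ℓ, S.dynamics g q i ℓ = 0

end BufferedNetwork

/-- The product over all nodes `i` and commodities `p` of the intervals `[lo i p, up i p]`. -/
def queueBox {V K : Type*} (lo up : V → K → ℝ) : Set (V → K → ℝ) :=
  {q | ∀ i p, q i p ∈ Set.Icc (lo i p) (up i p)}

/-! The sign conditions say that `f` does not point out of the box on any face, so the theorem is
Poincaré–Miranda (`exists_mem_Icc_eq_zero_of_faces`) on the box indexed by `V × K`. With `c` the
clamping onto the box, the bounded map `x ↦ c x + f (c x)` has a fixed point by Brouwer; the face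
conditions force it into the box, where `f` then vanishes.

Brouwer follows from the absence of a `C¹` retraction `r` of a ball onto its sphere, proved by
volume. Extend `h = r - id` by zero. For small `t`, `id + t h` permutes the ball, so `∫ det (1 + t
Dh)` is the volume of the ball. This integral is polynomial in `t`, so the same holds at `t = 1`;
but `det Dr = 0`, since `‖r‖` is constant. -/

open Polynomial in
/-- The determinant of `1 + t A` is the value at `t` of a polynomial of degree at most `dim E`. -/
theorem ContinuousLinearMap.exists_polynomial_eval_eq_det_one_add_smul {E : Type*}
    [NormedAddCommGroup E] [NormedSpace ℝ E] [FiniteDimensional ℝ E] (A : E →L[ℝ] E) :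
    ∃ p : ℝ[X], p.natDegree ≤ Module.finrank ℝ E ∧ ∀ t : ℝ, p.eval t = (1 + t • A).det := by
  classical
  let b := Module.finBasis ℝ E
  let M := LinearMap.toMatrix b b (A : E →ₗ[ℝ] E)
  refine ⟨Matrix.det ((X : ℝ[X]) • M.map C + (1 : Matrix _ _ ℝ).map C), ?_, fun t => ?_⟩
  · simpa using natDegree_det_X_add_C_le M 1
  · rw [ContinuousLinearMap.det, ← LinearMap.det_toMatrix b, ← coe_evalRingHom, RingHom.map_det]
    have : ((1 + t • A : E →L[ℝ] E) : E →ₗ[ℝ] E) = 1 + t • (A : E →ₗ[ℝ] E) := rfl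
    rw [this, map_add (LinearMap.toMatrix b b), map_smul (LinearMap.toMatrix b b),
      LinearMap.toMatrix_one]
    congr 1
    ext i j
    rcases eq_or_ne i j with rfl | hij
    · simp [M]; ring
    · simp [M, hij]; ring

/-- The determinants `det (1 + t A)`, for `t` in a finite set of more than `dim E` points,
determine `det (1 + A)` by Lagrange interpolation. -/
theorem ContinuousLinearMap.det_one_add_eq_sum {E : Type*}
    [NormedAddCommGroup E] [NormedSpace ℝ E] [FiniteDimensional ℝ E] (s : Finset ℝ)
    (hs : Module.finrank ℝ E < s.card) (A : E →L[ℝ] E) :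
    (1 + A).det = ∑ t ∈ s, (1 + t • A).det * (Lagrange.basis s id t).eval 1 := by
  obtain ⟨p, hp, hpe⟩ := A.exists_polynomial_eval_eq_det_one_add_smul
  have hdeg : p.degree < s.card :=
    Polynomial.degree_le_natDegree.trans_lt (by exact_mod_cast hp.trans_lt hs)
  have h := congrArg (Polynomial.eval 1)
    (Lagrange.eq_interpolate (v := id) (Set.injOn_id (s : Set ℝ)) hdeg)
  rw [hpe, one_smul] at h
  simpa [Lagrange.interpolate_apply, Polynomial.eval_finsetSum, hpe] using h

/-- Since `t • h` is a contraction, it cannot cancel a nonzero difference `x - y`, and solving for a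
preimage of `y` is a Banach fixed point problem for `x ↦ y - t • h x`. -/
theorem LipschitzWith.bijective_id_add_smul {E : Type*} [NormedAddCommGroup E] [NormedSpace ℝ E]
    [CompleteSpace E] {h : E → E} {K : NNReal} (hK : LipschitzWith K h) {t : ℝ}
    (ht : ‖t‖₊ * K < 1) : Function.Bijective fun x => x + t • h x := by
  have hL : LipschitzWith (‖t‖₊ * K) fun x => t • h x :=
    (lipschitzWith_smul t).comp hK
  refine ⟨fun x y hxy => ?_, fun y => ?_⟩
  · have h1 := hL.dist_le_mul y x
    have h2 : dist (t • h y) (t • h x) = dist x y := by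
      rw [dist_eq_norm, dist_eq_norm]
      congr 1
      have : x + t • h x = y + t • h y := hxy
      rw [sub_eq_sub_iff_add_eq_add, add_comm, ← this, add_comm, add_comm]
    rw [h2, dist_comm y x] at h1
    have ht' : ((‖t‖₊ * K : NNReal) : ℝ) < 1 := by exact_mod_cast ht
    exact dist_le_zero.1 (by nlinarith [dist_nonneg (x := x) (y := y)])
  · have hc : ContractingWith (‖t‖₊ * K) fun x => y - t • h x := by
      refine ⟨ht, LipschitzWith.of_dist_le_mul fun a b => ?_⟩
      rw [dist_sub_left]
      exact hL.dist_le_mul a b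
    obtain ⟨x, hx, -⟩ := hc.exists_fixedPoint y (edist_ne_top _ _)
    refine ⟨x, ?_⟩
    have hx' : y - t • h x = x := hx
    simpa using (sub_eq_iff_eq_add.1 hx').symm

open MeasureTheory Metric Set Filter Topology in
/-- If `h` is Lipschitz, differentiable on the set `B`, and vanishes off `B`, then for small `t`
the map `x + t h x` is a bijection of `B`, and so preserves its volume. -/
theorem LipschitzWith.eventually_integral_det_eq {E : Type*} [NormedAddCommGroup E]
    [NormedSpace ℝ E] [FiniteDimensional ℝ E] [MeasurableSpace E] [BorelSpace E]
    (μ : Measure E) [μ.IsAddHaarMeasure] {h : E → E} {K : NNReal} (hK : LipschitzWith K h)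
    {B : Set E} (hB : MeasurableSet B) (hfin : μ B ≠ ∞)
    (hd : ∀ x ∈ B, DifferentiableAt ℝ h x) (h0 : ∀ x ∉ B, h x = 0) :
    ∀ᶠ t in 𝓝 (0 : ℝ), IntegrableOn (fun x => (1 + t • fderiv ℝ h x).det) B μ ∧
      ∫ x in B, (1 + t • fderiv ℝ h x).det ∂μ = μ.real B := by
  -- Positivity of the determinant near `1` removes the absolute value from the change of variables
  -- formula for small `t`.
  have hpos : ∀ᶠ A in 𝓝 (1 : E →L[ℝ] E), 0 < A.det := by
    refine ContinuousLinearMap.continuous_det.continuousAt.eventually (lt_mem_nhds ?_)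
    simp [ContinuousLinearMap.det]
  obtain ⟨ε, hε, hball⟩ := Metric.eventually_nhds_iff.1 hpos
  have e1 : ∀ᶠ t in 𝓝 (0 : ℝ), ‖t‖₊ * K < 1 := by
    have : Continuous fun t : ℝ => ‖t‖₊ * K := by fun_prop
    exact this.continuousAt.eventually (gt_mem_nhds (by simp))
  have e2 : ∀ᶠ t in 𝓝 (0 : ℝ), ‖t‖ * K < ε := by
    have : Continuous fun t : ℝ => ‖t‖ * K := by fun_prop
    exact this.continuousAt.eventually (gt_mem_nhds (by simpa))
  filter_upwards [e1, e2] with t h1 h2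
  have hbij := hK.bijective_id_add_smul h1
  set F : E → E := fun x => x + t • h x with hF
  have hoff : ∀ x ∉ B, F x = x := fun x hx => by simp [hF, h0 x hx]
  have himg : F '' B = B := by
    apply Subset.antisymm
    · rintro _ ⟨x, hx, rfl⟩
      by_contra hn
      have := hbij.1 (hoff _ hn)
      exact hn (by rwa [this])
    · intro y hy
      obtain ⟨x, rfl⟩ := hbij.2 y
      refine ⟨x, ?_, rfl⟩
      by_contra hn
      rw [hoff x hn] at hy
      exact hn hy
  have hder : ∀ x ∈ B, HasFDerivWithinAt F (1 + t • fderiv ℝ h x) B x := fun x hx =>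
    ((hasFDerivAt_id x).add ((hd x hx).hasFDerivAt.const_smul t)).hasFDerivWithinAt
  have habs : ∀ x, |(1 + t • fderiv ℝ h x).det| = (1 + t • fderiv ℝ h x).det := fun x => by
    refine abs_of_pos (hball ?_)
    rw [dist_eq_norm, add_sub_cancel_left, norm_smul]
    exact (mul_le_mul_of_nonneg_left (norm_fderiv_le_of_lipschitz ℝ hK) (norm_nonneg _)).trans_lt h2
  have hi := integrableOn_image_iff_integrableOn_abs_det_fderiv_smul μ hB hder hbij.1.injOn
    (fun _ => (1 : ℝ))
  have hv := integral_image_eq_integral_abs_det_fderiv_smul μ hB hder hbij.1.injOn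
    (fun _ => (1 : ℝ))
  rw [himg] at hi hv
  simp only [habs, smul_eq_mul, mul_one] at hi hv
  exact ⟨hi.1 (integrableOn_const hfin), by rw [← hv]; simp⟩

open MeasureTheory Metric Set Filter Topology in
/-- A Lipschitz perturbation of the identity supported in a ball, and differentiable there, has a
nonsingular derivative at some point of the ball. -/
theorem LipschitzWith.exists_det_one_add_fderiv_ne_zero {E : Type*} [NormedAddCommGroup E]
    [NormedSpace ℝ E] [FiniteDimensional ℝ E] {h : E → E} {K : NNReal}
    (hK : LipschitzWith K h) {R : ℝ} (hR : 0 < R)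
    (hd : ∀ x ∈ ball (0 : E) R, DifferentiableAt ℝ h x) (h0 : ∀ x ∉ ball (0 : E) R, h x = 0) :
    ∃ x ∈ ball (0 : E) R, (1 + fderiv ℝ h x).det ≠ 0 := by
  by_contra! hdet
  borelize E
  let μ : Measure E := Measure.addHaar
  have hev := hK.eventually_integral_det_eq μ measurableSet_ball measure_ball_lt_top.ne hd h0
  have hinf : {t : ℝ | IntegrableOn (fun x => (1 + t • fderiv ℝ h x).det) (ball 0 R) μ ∧
      ∫ x in ball 0 R, (1 + t • fderiv ℝ h x).det ∂μ = μ.real (ball 0 R)}.Infinite :=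
    infinite_of_mem_nhds 0 hev
  -- Degree at most `dim E` calls for `dim E + 1` interpolation nodes, all taken among the good
  -- small `t`.
  obtain ⟨s, hs, hcard⟩ := hinf.exists_subset_card_eq (Module.finrank ℝ E + 1)
  have key : ∫ x in ball 0 R, (1 + fderiv ℝ h x).det ∂μ = μ.real (ball 0 R) := by
    simp_rw [fun x => (fderiv ℝ h x).det_one_add_eq_sum s (by omega)]
    rw [integral_finsetSum _ fun t ht => (hs ht).1.mul_const _]
    simp_rw [integral_mul_const]
    rw [Finset.sum_congr rfl fun t ht => by rw [(hs ht).2], ← Finset.mul_sum]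
    have hne : s.Nonempty := Finset.card_pos.1 (by omega)
    have h1 := congrArg (Polynomial.eval 1)
      (Lagrange.sum_basis (v := id) (Set.injOn_id (s : Set ℝ)) hne)
    rw [Polynomial.eval_finsetSum, Polynomial.eval_one] at h1
    rw [h1, mul_one]
  rw [setIntegral_congr_fun measurableSet_ball hdet] at key
  have hp : 0 < μ.real (ball 0 R) :=
    ENNReal.toReal_pos (measure_ball_pos μ 0 hR).ne' measure_ball_lt_top.ne
  simp at key
  linarith

open Metric Set in
/-- Extending by zero a Lipschitz function on a ball that vanishes on the sphere. -/
theorem LipschitzOnWith.lipschitzWith_indicator_ball {E F : Type*} [NormedAddCommGroup E]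
    [NormedSpace ℝ E] [NormedAddCommGroup F] {h : E → F} {K : NNReal} {R : ℝ}
    (hK : LipschitzOnWith K h (closedBall 0 R)) (h0 : ∀ x ∈ sphere (0 : E) R, h x = 0) :
    LipschitzWith K ((ball 0 R).indicator h) := by
  -- The segment from `x` to `y` meets the sphere at a point `z` where `h` vanishes, and `z` is no
  -- farther from `x` than `y` is.
  have aux : ∀ x ∈ ball (0 : E) R, ∀ y ∉ ball (0 : E) R, ‖h x‖ ≤ K * dist x y := by
    intro x hx y hy
    have hc : ContinuousOn (fun c : ℝ => ‖AffineMap.lineMap x y c‖) (Icc 0 1) := by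
      have : Continuous fun c : ℝ => (AffineMap.lineMap x y c : E) :=
        AffineMap.lineMap_continuous
      exact this.norm.continuousOn
    rw [mem_ball_zero_iff] at hx hy
    obtain ⟨c, hc1, hc2⟩ := intermediate_value_Icc zero_le_one hc
      (show R ∈ Icc _ _ by simpa using ⟨hx.le, not_lt.1 hy⟩)
    set z : E := AffineMap.lineMap x y c
    have hz : z ∈ sphere (0 : E) R := by simpa using hc2
    have h1 := hK.dist_le_mul x (by simpa using hx.le) z (sphere_subset_closedBall hz)
    rw [h0 z hz, dist_zero_right, dist_left_lineMap, Real.norm_of_nonneg hc1.1] at h1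
    exact h1.trans (mul_le_mul_of_nonneg_left
      (mul_le_of_le_one_left dist_nonneg hc1.2) K.coe_nonneg)
  refine LipschitzWith.of_dist_le_mul fun x y => ?_
  by_cases hx : x ∈ ball (0 : E) R <;> by_cases hy : y ∈ ball (0 : E) R
  · simpa [hx, hy, -mem_ball] using
      hK.dist_le_mul x (ball_subset_closedBall hx) y (ball_subset_closedBall hy)
  · simpa [hx, hy, -mem_ball] using aux x hx y hy
  · simpa [hx, hy, -mem_ball, dist_comm x y] using aux y hy x hx
  · simp only [indicator_of_notMem hx, indicator_of_notMem hy, dist_self]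
    positivity

open Metric Set in
/-- There is no `C¹` retraction of a ball onto its boundary sphere. -/
theorem not_exists_contDiffAt_retraction {E : Type*} [NormedAddCommGroup E]
    [InnerProductSpace ℝ E] [FiniteDimensional ℝ E] {R : ℝ} (hR : 0 < R) {r : E → E}
    (hr : ∀ x ∈ closedBall (0 : E) R, ContDiffAt ℝ 1 r x)
    (hmem : ∀ x ∈ closedBall (0 : E) R, ‖r x‖ = R) (hfix : ∀ x ∈ sphere (0 : E) R, r x = x) :
    False := by
  have hlip : LocallyLipschitzOn (closedBall (0 : E) R) fun x => r x - x := by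
    intro x hx
    obtain ⟨K, t, ht, h⟩ := ((hr x hx).sub contDiffAt_id).exists_lipschitzOnWith
    exact ⟨K, t, mem_nhdsWithin_of_mem_nhds ht, h⟩
  obtain ⟨K, hK⟩ := hlip.exists_lipschitzOnWith_of_compact (isCompact_closedBall 0 R)
  have hK' := hK.lipschitzWith_indicator_ball fun x hx => by rw [hfix x hx, sub_self]
  have hder : ∀ x ∈ ball (0 : E) R, HasFDerivAt ((ball (0 : E) R).indicator fun x => r x - x)
      (fderiv ℝ r x - 1) x := by
    intro x hx
    have h1 := ((hr x (ball_subset_closedBall hx)).differentiableAt one_ne_zero).hasFDerivAt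
    refine (h1.sub (hasFDerivAt_id x)).congr_of_eventuallyEq ?_
    filter_upwards [isOpen_ball.mem_nhds hx] with y hy
    exact indicator_of_mem hy _
  obtain ⟨x, hx, hdet⟩ := hK'.exists_det_one_add_fderiv_ne_zero hR
    (fun x hx => (hder x hx).differentiableAt) fun x hx => indicator_of_notMem hx _
  rw [(hder x hx).fderiv, add_sub_cancel] at hdet
  have h1 := ((hr x (ball_subset_closedBall hx)).differentiableAt one_ne_zero).hasFDerivAt
  -- Constancy of `‖r‖ ^ 2` makes `r x` orthogonal to the range of the derivative; surjectivity puts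
  -- `r x` in that range, forcing `R = 0`.
  have h2 : HasFDerivAt (fun y => ‖r y‖ ^ 2) (0 : E →L[ℝ] ℝ) x := by
    refine (hasFDerivAt_const (R ^ 2) x).congr_of_eventuallyEq ?_
    filter_upwards [isOpen_ball.mem_nhds hx] with y hy
    rw [hmem y (ball_subset_closedBall hy)]
  have h3 := h2.unique h1.norm_sq
  have hsurj : Function.Surjective (fderiv ℝ r x) := by
    have hu := LinearMap.isUnit_iff_isUnit_det (fderiv ℝ r x : E →ₗ[ℝ] E) |>.2
      (isUnit_iff_ne_zero.2 hdet)
    exact ((Module.End.isUnit_iff _).1 hu).2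
  obtain ⟨v, hv⟩ := hsurj (r x)
  have h4 := congrArg (fun L : E →L[ℝ] ℝ => L v) h3
  have h5 : ‖r x‖ = R := hmem x (ball_subset_closedBall hx)
  simp [hv, h5, hR.ne'] at h4

open Metric in
/-- **Brouwer's fixed point theorem** for `C¹` maps: otherwise the map sending `x` to the point where
the ray from `p x` through `x` leaves the ball would be a `C¹` retraction onto the sphere. -/
theorem exists_fixedPoint_of_contDiff {E : Type*} [NormedAddCommGroup E]
    [InnerProductSpace ℝ E] [FiniteDimensional ℝ E] {R : ℝ} (hR : 0 < R) {p : E → E}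
    (hp : ContDiff ℝ 1 p) (hlt : ∀ x, ‖p x‖ < R) : ∃ x ∈ closedBall (0 : E) R, p x = x := by
  by_contra! hne
  let u : E → E := fun x => x - p x
  let a : E → ℝ := fun x => inner ℝ x (u x)
  let b : E → ℝ := fun x => ‖u x‖ ^ 2
  let D : E → ℝ := fun x => a x ^ 2 + b x * (R ^ 2 - ‖x‖ ^ 2)
  -- The larger root of `‖x + s • u x‖ ^ 2 = R ^ 2`, a quadratic in `s` with quarter discriminant `D
  -- x`.
  let s : E → ℝ := fun x => (-a x + √(D x)) / b x
  have hu : ContDiff ℝ 1 u := contDiff_id.sub hp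
  have ha : ContDiff ℝ 1 a := contDiff_id.inner ℝ hu
  have hb : ContDiff ℝ 1 b := hu.norm_sq ℝ
  have hD : ContDiff ℝ 1 D := (ha.pow 2).add (hb.mul (contDiff_const.sub (contDiff_id.norm_sq ℝ)))
  have hbpos : ∀ x ∈ closedBall (0 : E) R, 0 < b x := fun x hx =>
    pow_pos (norm_pos_iff.2 (sub_ne_zero.2 (hne x hx).symm)) 2
  -- On the sphere `D x = a x ^ 2`; positivity of `a x` keeps the square root smooth there and makes
  -- the root `s x` zero.
  have hapos : ∀ x, ‖x‖ = R → 0 < a x := by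
    intro x hx
    have h1 : a x = R ^ 2 - inner ℝ x (p x) := by
      simp only [a, u, inner_sub_right, real_inner_self_eq_norm_sq, hx]
    have h2 := real_inner_le_norm x (p x)
    rw [hx] at h2
    have := mul_lt_mul_of_pos_left (hlt x) hR
    rw [h1]
    nlinarith
  have hDpos : ∀ x ∈ closedBall (0 : E) R, 0 < D x := by
    intro x hx
    rcases (mem_closedBall_zero_iff.1 hx).lt_or_eq with h | h
    · have : 0 < R ^ 2 - ‖x‖ ^ 2 := sub_pos.2 (pow_lt_pow_left₀ h (norm_nonneg x) two_ne_zero)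
      exact add_pos_of_nonneg_of_pos (sq_nonneg _) (mul_pos (hbpos x hx) this)
    · simp only [D, h, sub_self, mul_zero, add_zero]
      exact pow_pos (hapos x h) 2
  refine not_exists_contDiffAt_retraction hR (r := fun x => x + s x • u x) ?_ ?_ ?_
  · intro x hx
    refine contDiffAt_id.add (ContDiffAt.smul ?_ hu.contDiffAt)
    exact (ha.contDiffAt.neg.add (hD.contDiffAt.sqrt (hDpos x hx).ne')).div hb.contDiffAt
      (hbpos x hx).ne'
  · intro x hx
    have hs : b x * s x + a x = √(D x) := by
      simp only [s]
      field_simp [(hbpos x hx).ne']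
      ring
    have hsq : (b x * s x + a x) ^ 2 = D x := by rw [hs, Real.sq_sqrt (hDpos x hx).le]
    have hexp : ‖x + s x • u x‖ ^ 2 = ‖x‖ ^ 2 + 2 * (s x * a x) + s x ^ 2 * b x := by
      rw [norm_add_sq_real, inner_smul_right, norm_smul, mul_pow, Real.norm_eq_abs, sq_abs]
    rw [← sq_eq_sq₀ (norm_nonneg _) hR.le, hexp]
    refine mul_left_cancel₀ (hbpos x hx).ne' ?_
    simp only [D] at hsq
    linear_combination hsq
  · intro x hx
    have hx' : ‖x‖ = R := by simpa using hx
    have : s x = 0 := by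
      simp only [s, D, hx', sub_self, mul_zero, add_zero, Real.sqrt_sq (hapos x hx').le,
        neg_add_cancel, zero_div]
    rw [this, zero_smul, add_zero]

open Metric in
/-- **Brouwer's fixed point theorem** for bounded continuous maps of a Euclidean space. -/
theorem Continuous.exists_fixedPoint_of_norm_lt {E : Type*} [NormedAddCommGroup E]
    [InnerProductSpace ℝ E] [FiniteDimensional ℝ E] {R : ℝ} {G : E → E}
    (hG : Continuous G) (hlt : ∀ x, ‖G x‖ < R) : ∃ x, G x = x := by
  have hR : 0 < R := (norm_nonneg _).trans_lt (hlt 0)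
  by_contra! hne
  -- Radius `R + 1` leaves room for an approximation of `G` within `1`. One also closer than the
  -- minimal displacement of `G` has no fixed point in this ball.
  obtain ⟨z, -, hz⟩ := (isCompact_closedBall (0 : E) (R + 1)).exists_isMinOn
    ⟨0, by simp; linarith⟩ (f := fun x => ‖G x - x‖) (by fun_prop)
  have hε : 0 < min 1 ‖G z - z‖ := lt_min one_pos (norm_pos_iff.2 (sub_ne_zero.2 (hne z)))
  obtain ⟨p, hp, happ, -⟩ := hG.exists_contDiff_approx 1 (continuous_const
    (y := min 1 ‖G z - z‖)) fun _ => hε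
  obtain ⟨x, hx, hfix⟩ := exists_fixedPoint_of_contDiff (R := R + 1) (by linarith)
    (by exact_mod_cast hp) fun x => by
      have h1 := (happ x).trans_le (min_le_left _ _)
      rw [dist_eq_norm] at h1
      have h2 := norm_add_le (p x - G x) (G x)
      rw [sub_add_cancel] at h2
      linarith [hlt x]
  have h1 := (happ x).trans_le (min_le_right _ _)
  rw [hfix, dist_comm, dist_eq_norm] at h1
  exact absurd (hz hx) (not_le.2 h1)

open Set in
/-- **Poincaré–Miranda theorem**: a continuous vector field on a box that does not point outwards
on any face of the box has a zero. -/
theorem exists_mem_Icc_eq_zero_of_faces {ι : Type*} [Fintype ι] {lo up : ι → ℝ} (hle : lo ≤ up)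
    {f : (ι → ℝ) → ι → ℝ} (hf : ContinuousOn f (Icc lo up))
    (hup : ∀ i, ∀ x ∈ Icc lo up, x i = up i → f x i ≤ 0)
    (hlo : ∀ i, ∀ x ∈ Icc lo up, x i = lo i → 0 ≤ f x i) :
    ∃ x ∈ Icc lo up, f x = 0 := by
  let c : (ι → ℝ) → ι → ℝ := fun x i => max (lo i) (min (up i) (x i))
  have hc : Continuous c := by fun_prop
  have hcm : ∀ x, c x ∈ Icc lo up := fun x =>
    ⟨fun i => le_max_left _ _, fun i => max_le (hle i) (min_le_left _ _)⟩
  let g : (ι → ℝ) → ι → ℝ := fun x => x + f x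
  have hg : ContinuousOn g (Icc lo up) := continuousOn_id.add hf
  have hgc : Continuous fun x => g (c x) := hg.comp_continuous hc hcm
  have hL : Continuous (WithLp.toLp 2 : (ι → ℝ) → EuclideanSpace ℝ ι) := PiLp.continuous_toLp 2 _
  have hL' : Continuous (WithLp.ofLp : EuclideanSpace ℝ ι → ι → ℝ) := PiLp.continuous_ofLp 2 _
  obtain ⟨M, hM⟩ := isCompact_Icc.exists_bound_of_continuousOn (hL.comp_continuousOn hg)
  obtain ⟨y, hy⟩ := (hL.comp (hgc.comp hL')).exists_fixedPoint_of_norm_lt (R := M + 1)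
    fun x => (hM _ (hcm _)).trans_lt (lt_add_one M)
  set x : ι → ℝ := WithLp.ofLp y
  have hx : ∀ i, c x i + f (c x) i = x i := fun i => congrFun (congrArg WithLp.ofLp hy) i
  have hcx : c x = x := by
    ext i
    have h := hx i
    -- If `x i < lo i`, then `c x` lies on the lower face, so `x i = lo i + f (c x) i ≥ lo i`, a
    -- contradiction; the upper case is symmetric.
    rcases lt_or_ge (x i) (lo i) with h1 | h1
    · have e : c x i = lo i := max_eq_left ((min_le_right _ _).trans h1.le)
      linarith [hlo i _ (hcm x) e]
    rcases lt_or_ge (up i) (x i) with h2 | h2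
    · have e : c x i = up i := by simp only [c, min_eq_left h2.le, max_eq_right (hle i)]
      linarith [hup i _ (hcm x) e]
    · simp only [c, min_eq_right h2, max_eq_right h1]
  refine ⟨x, hcx ▸ hcm x, funext fun i => ?_⟩
  have h := hx i
  rw [hcx] at h
  simpa using h

open Set in
theorem BufferedNetwork.ContinuousPolicy.continuousOn_dynamics {V K : Type*} [Fintype V]
    [Fintype K] {S : BufferedNetwork V K} {g : LocalPolicy V K} (hg : S.ContinuousPolicy g)
    (i : V) (ℓ : K) : ContinuousOn (fun q => S.dynamics g q i ℓ) S.feasible := by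
  classical
  have hev : ∀ i, ContinuousOn (fun q : V → K → ℝ => q i) S.feasible := fun i =>
    (continuous_apply i).continuousOn
  have hrate : ∀ i j, S.graph.Adj i j →
      ContinuousOn (fun q : V → K → ℝ => g.rate ℓ i j (q i) (q j)) S.feasible := fun i j hij =>
    (hg.rate ℓ i j hij).comp ((hev i).prodMk (hev j)) fun q hq => ⟨hq i, hq j⟩
  unfold BufferedNetwork.dynamics
  refine ((continuousOn_const.add (continuousOn_finsetSum _ fun k hk => ?_)).sub
    (continuousOn_finsetSum _ fun j hj => ?_)).sub ((hg.depart ℓ i).comp (hev i) fun q hq => hq i)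
  · exact hrate k i (by simpa using hk)
  · exact hrate i j (by simpa using hj)

theorem mainTheorem8 {V K : Type*} [Fintype V] [Fintype K]
    (S : BufferedNetwork V K) (g : LocalPolicy V K) (hg : S.ContinuousPolicy g)
    (lo up : V → K → ℝ)
    (hle : ∀ i p, lo i p ≤ up i p)
    (hbox : queueBox lo up ⊆ S.feasible)
    (hupper : ∀ ℓ i, ∀ q ∈ queueBox lo up, q i ℓ = up i ℓ → S.dynamics g q i ℓ ≤ 0)
    (hlower : ∀ ℓ i, ∀ q ∈ queueBox lo up, q i ℓ = lo i ℓ → 0 ≤ S.dynamics g q i ℓ) :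
    ∃ q ∈ queueBox lo up, q ∈ S.feasible ∧ S.IsEquilibrium g q := by
  let cur : (V × K → ℝ) → V → K → ℝ := Function.curry
  have hcur : Continuous cur := by
    refine continuous_pi fun i => continuous_pi fun p => continuous_apply (i, p)
  have hmem : ∀ x ∈ Set.Icc (Function.uncurry lo) (Function.uncurry up), cur x ∈ queueBox lo up :=
    fun x hx i p => ⟨hx.1 (i, p), hx.2 (i, p)⟩
  obtain ⟨x, hx, hzero⟩ := exists_mem_Icc_eq_zero_of_faces
    (lo := Function.uncurry lo) (up := Function.uncurry up) (fun a => hle a.1 a.2)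
    (f := fun x a => S.dynamics g (cur x) a.1 a.2)
    (continuousOn_pi.2 fun a => (hg.continuousOn_dynamics a.1 a.2).comp hcur.continuousOn
      fun x hx => hbox (hmem x hx))
    (fun a x hx h => hupper a.2 a.1 _ (hmem x hx) h)
    (fun a x hx h => hlower a.2 a.1 _ (hmem x hx) h)
  exact ⟨cur x, hmem x hx, hbox (hmem x hx), fun i ℓ => congrFun hzero (i, ℓ)⟩
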